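/- A digital image $(X,\kappa)$ is a set $X$ with a symmetric irreflexive adjacency relation $\kappa$; a subset of a digital image carries the induced adjacency. A subset is connected if any two of its points are joined inside it by a finite sequence of successively adjacent points; a map of digital images is continuous if it maps connected sets to connected sets (equivalently, adjacent points to equal or adjacent points). The interval $[0,m]_{\mathbb Z}$ carries the adjacency $|a-b|=1$. A homotopy between continuous maps $f,g:X\to Y$ is a function $F:X\times[0,m]_{\mathbb Z}\to Y$, for some $m\ge 1$, with $F(\cdot,0)=f$, $F(\cdot,m)=g$, such that every $F(x,\cdot)$ and every $F(\cdot,t)$ is continuous. $X$ is contractible if its identity map is homotopic to a constant map $X\to X$. A set $S\subset(X,\kappa)$ is a digital simple closed curve if $S=\{x_0,\dots,x_{m-1}\}$ with $m\ge 4$ distinct points such that $x_i$ and $x_j$ are adjacent if and only if $j\equiv i\pm1 \pmod m$. A loop in $X$ based at $x_0$ is a continuous map $f:[0,m]_{\mathbb Z}\to X$, $m\ge 0$, with $f(0)=f(m)=x_0$. A trivial extension of $f$ is a map obtained from $f$ by inserting finitely many constant paths, i.e. a map $f\circ r$ with $r:[0,m']_{\mathbb Z}\to[0,m]_{\mathbb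 Z}$ monotone and surjective. Two loops based at $x_0$ lie in the same loop class if they have trivial extensions of a common length that are joined by a homotopy keeping both endpoints at $x_0$. The digital fundamental group $\Pi_1^{\kappa}(X,x_0)$ is the set of loop classes, with the product $[f]\cdot[g]=[f*g]$ induced by concatenation of loops. For digital images $(X_i,\kappa_i)$, $1\le i\le v$, two points $p,q$ of $\prod_{i=1}^v X_i$ are $NP_v(\kappa_1,\dots,\kappa_v)$-adjacent if for at least one and at most $v$ indices $i$ the coordinates $p_i,q_i$ are $\kappa_i$-adjacent, and $p_i=q_i$ for all other indices $i$. Theorem. Let $v$ be a positive integer. For $i=1,\dots,v$ let $\kappa_i$ be an adjacency relation on $\mathbb Z^{n_i}$, let $S_i\subset(\mathbb Z^{n_i},\kappa_i)$ be a digital simple closed curve such that $(S_i,\kappa_i)$ is not contractible, and let $s_i\in S_i$. Then there is an isomorphism of groups $$\Pi_1^{NP_v(\kappa_1,\dots,\kappa_v)}\Bigl(\prod_{i=1}^v S_i,\,(s_1,\dots,s_v)\Bigr)\;\cong\;\mathbb Z^v .$$ -/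

import Mathlib

namespace DigitalTopology

/-! A digital image `(X, κ)` is a type `X` (in the application a subset of some `ℤ^n`, or a product
of such subsets) with an adjacency relation, i.e. a simple graph `κ : SimpleGraph X`. The integer
interval `[0,m]_ℤ` with its `c₁`-adjacency is `SimpleGraph.pathGraph (m + 1)` on `Fin (m + 1)`. -/

section Basic

variable {X Y : Type*}

/-- A subset `A` of `(X, κ)` is connected: any two points of `A` are joined inside `A` by a
sequence of successively adjacent points (the empty set is connected). -/
def IsConn (κ : SimpleGraph X) (A : Set X) : Prop := (κ.induce A).Preconnected

/-- Digital continuity: images of connected sets are connected. -/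
def DigContinuous (κ : SimpleGraph X) (l : SimpleGraph Y) (f : X → Y) : Prop :=
  ∀ A : Set X, IsConn κ A → IsConn l (f '' A)

/-- Two points are equal or adjacent. -/
def Near (κ : SimpleGraph X) (x y : X) : Prop := x = y ∨ κ.Adj x y

lemma Near.symm {κ : SimpleGraph X} {x y : X} (h : Near κ x y) : Near κ y x :=
  h.elim (fun h => Or.inl h.symm) (fun h => Or.inr h.symm)

lemma Near.refl (κ : SimpleGraph X) (x : X) : Near κ x x := Or.inl rfl

/-- Continuity in terms of adjacency of points. -/
theorem digContinuous_iff (κ : SimpleGraph X) (l : SimpleGraph Y) (f : X → Y) :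
    DigContinuous κ l f ↔ ∀ x x', κ.Adj x x' → Near l (f x) (f x') := by
  constructor
  · intro h x x' hx
    have hA : IsConn κ {x, x'} := by
      have hadj : (κ.induce ({x, x'} : Set X)).Adj ⟨x, by simp⟩ ⟨x', by simp⟩ := hx
      rintro ⟨a, ha⟩ ⟨b, hb⟩
      rcases ha with rfl | rfl <;> rcases hb with rfl | rfl
      · exact SimpleGraph.Reachable.refl _
      · exact hadj.reachable
      · exact hadj.symm.reachable
      · exact SimpleGraph.Reachable.refl _
    obtain ⟨w⟩ := h _ hA ⟨f x, x, by simp, rfl⟩ ⟨f x', x', by simp, rfl⟩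
    generalize hp : (⟨f x, x, by simp, rfl⟩ : f '' {x, x'}) = p at w
    generalize hq : (⟨f x', x', by simp, rfl⟩ : f '' {x, x'}) = q at w
    by_cases hne : f x = f x'
    · exact Or.inl hne
    · right
      cases w with
      | nil => exact absurd (congrArg Subtype.val (hp.trans hq.symm)) hne
      | @cons _ c _ hc _ =>
        obtain ⟨c, y, hy, rfl⟩ := c
        subst hp
        have hc' : l.Adj (f x) (f y) := hc
        rcases hy with rfl | rfl
        · exact absurd hc' (l.loopless.irrefl _)
        · exact hc'
  · intro h A hA
    rintro ⟨_, a, ha, rfl⟩ ⟨_, b, hb, rfl⟩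
    have key : ∀ (p q : A), (κ.induce A).Walk p q →
        (l.induce (f '' A)).Reachable ⟨f p, p, p.2, rfl⟩ ⟨f q, q, q.2, rfl⟩ := by
      intro p q w
      induction w with
      | nil => exact SimpleGraph.Reachable.refl _
      | @cons u v w huv _ ih =>
        refine SimpleGraph.Reachable.trans ?_ ih
        rcases h u v huv with he | he
        · simp only [he]
          exact SimpleGraph.Reachable.refl _
        · have : (l.induce (f '' A)).Adj ⟨f u, u, u.2, rfl⟩ ⟨f v, v, v.2, rfl⟩ := he
          exact this.reachable
    obtain ⟨w⟩ := hA ⟨a, ha⟩ ⟨b, hb⟩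
    exact key _ _ w

/-- Continuity on an integer interval. -/
theorem digContinuous_path_iff (l : SimpleGraph Y) {m : ℕ} (f : Fin (m + 1) → Y) :
    DigContinuous (SimpleGraph.pathGraph (m + 1)) l f ↔
      ∀ (i : ℕ) (h : i + 1 < m + 1), Near l (f ⟨i, by omega⟩) (f ⟨i + 1, h⟩) := by
  rw [digContinuous_iff]
  constructor
  · intro h i hi
    exact h _ _ (SimpleGraph.pathGraph_adj.2 (Or.inl rfl))
  · rintro h ⟨i, hi⟩ ⟨j, hj⟩ hij
    rcases SimpleGraph.pathGraph_adj.1 hij with he | he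
    · simp only at he
      subst he
      exact h _ _
    · simp only at he
      subst he
      exact (h _ _).symm

/-- `F` is a digital homotopy, over the time interval `[0,m]_ℤ`, between `f` and `g`. -/
structure IsHomotopy (κ : SimpleGraph X) (l : SimpleGraph Y) (f g : X → Y) (m : ℕ)
    (F : X → Fin (m + 1) → Y) : Prop where
  pos : 0 < m
  cont_left : DigContinuous κ l f
  cont_right : DigContinuous κ l g
  start : ∀ x, F x 0 = f x
  finish : ∀ x, F x (Fin.last m) = g x
  cont_time : ∀ x, DigContinuous (SimpleGraph.pathGraph (m + 1)) l (F x)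
  cont_space : ∀ t, DigContinuous κ l (fun x => F x t)

/-- `(X, κ)` is contractible: the identity is homotopic to a constant map. -/
def IsContractible (κ : SimpleGraph X) : Prop :=
  ∃ (c : X) (m : ℕ) (F : X → Fin (m + 1) → X), IsHomotopy κ κ id (fun _ => c) m F

/-- `S ⊆ (X, κ)` is a digital simple closed curve: its points can be listed without repetition as
`f 0, …, f (m - 1)`, `m ≥ 4`, with `f i`, `f j` adjacent iff `j = i ± 1` modulo `m`. -/
def IsSimpleClosedCurve (κ : SimpleGraph X) (S : Set X) : Prop :=
  ∃ m : ℕ, 4 ≤ m ∧ ∃ f : Fin m → X, Function.Injective f ∧ Set.range f = S ∧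
    ∀ i j : Fin m, κ.Adj (f i) (f j) ↔
      (i.val + 1) % m = j.val ∨ (j.val + 1) % m = i.val

/-- The generalized normal product adjacency `NP_u(κ_1, …, κ_v)`: at least one and at most `u`
coordinates are adjacent, and all other coordinates are equal. -/
def NP {v : ℕ} (u : ℕ) {Z : Fin v → Type*} (κ : ∀ i, SimpleGraph (Z i)) :
    SimpleGraph (∀ i, Z i) where
  Adj p q := 1 ≤ {i | (κ i).Adj (p i) (q i)}.ncard ∧ {i | (κ i).Adj (p i) (q i)}.ncard ≤ u ∧
    ∀ i, ¬ (κ i).Adj (p i) (q i) → p i = q i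
  symm := ⟨by
    rintro p q ⟨h1, h2, h3⟩
    have e : {i | (κ i).Adj (q i) (p i)} = {i | (κ i).Adj (p i) (q i)} := by
      ext i
      exact (κ i).adj_comm _ _
    rw [e]
    exact ⟨h1, h2, fun i hi => (h3 i (fun h => hi h.symm)).symm⟩⟩
  loopless := ⟨by
    rintro p ⟨h1, -, -⟩
    simp at h1⟩

end Basic

section FundamentalGroup

variable {X : Type*}

/-- A `κ`-loop based at `x₀`: a continuous map `[0,m]_ℤ → X` with both endpoints sent to `x₀`. -/
structure DigLoop (κ : SimpleGraph X) (x₀ : X) where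
  len : ℕ
  toFun : Fin (len + 1) → X
  cont : DigContinuous (SimpleGraph.pathGraph (len + 1)) κ toFun
  source : toFun 0 = x₀
  target : toFun (Fin.last len) = x₀

/-- `f' : [0,n]_ℤ → X` is a trivial extension of `f : [0,m]_ℤ → X`: it is obtained from `f` by
inserting finitely many constant paths, i.e. it runs through `f` in order, with pauses. -/
def IsTrivialExtension {m n : ℕ} (f : Fin (m + 1) → X) (f' : Fin (n + 1) → X) : Prop :=
  ∃ r : Fin (n + 1) → Fin (m + 1), Monotone r ∧ Function.Surjective r ∧ ∀ i, f' i = f (r i)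

variable {κ : SimpleGraph X} {x₀ : X}

namespace DigLoop

/-- Two loops are in the same loop class: they have trivial extensions (of a common length) joined
by a homotopy that keeps the endpoints fixed. -/
def SameClass (f g : DigLoop κ x₀) : Prop :=
  ∃ (n : ℕ) (f' g' : Fin (n + 1) → X), IsTrivialExtension f.toFun f' ∧
    IsTrivialExtension g.toFun g' ∧
    ∃ (m : ℕ) (F : Fin (n + 1) → Fin (m + 1) → X),
      IsHomotopy (SimpleGraph.pathGraph (n + 1)) κ f' g' m F ∧
      ∀ t, F 0 t = x₀ ∧ F (Fin.last n) t = x₀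

/-- The constant loop of length `0`. -/
def const (κ : SimpleGraph X) (x₀ : X) : DigLoop κ x₀ where
  len := 0
  toFun _ := x₀
  cont := (digContinuous_path_iff _ _).2 fun _ _ => Near.refl _ _
  source := rfl
  target := rfl

/-- The product `f * g` of loops of lengths `m₁`, `m₂`: the loop of length `m₁ + m₂` that runs
through `f` and then through `g`. -/
def concat (f g : DigLoop κ x₀) : DigLoop κ x₀ where
  len := f.len + g.len
  toFun i := if h : i.val ≤ f.len then f.toFun ⟨i.val, by omega⟩
    else g.toFun ⟨i.val - f.len, by omega⟩
  cont := by
    rw [digContinuous_path_iff]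
    intro i hi
    rcases lt_trichotomy i f.len with h | h | h
    · simp only [h.le, show i + 1 ≤ f.len by omega, dite_true]
      exact (digContinuous_path_iff _ _).1 f.cont i (by omega)
    · subst h
      have hg := (digContinuous_path_iff _ _).1 g.cont 0 (by omega)
      simp only [le_refl, show ¬ (f.len + 1 ≤ f.len) by omega, dite_true, dite_false]
      have e1 : f.toFun ⟨f.len, by omega⟩ = g.toFun ⟨0, by omega⟩ :=
        f.target.trans g.source.symm
      simp only [e1, show f.len + 1 - f.len = 0 + 1 by omega]
      exact hg
    · simp only [show ¬ (i ≤ f.len) by omega, show ¬ (i + 1 ≤ f.len) by omega, dite_false,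
        show i + 1 - f.len = (i - f.len) + 1 by omega]
      exact (digContinuous_path_iff _ _).1 g.cont (i - f.len) (by omega)
  source := by
    simp only [Fin.val_zero, Nat.zero_le]
    exact f.source
  target := by
    simp only [Fin.val_last]
    split_ifs with h
    · have h0 : g.len = 0 := by omega
      simp only [h0, Nat.add_zero]
      exact f.target
    · simp only [Nat.add_sub_cancel_left]
      exact g.target

/-- The reverse loop. -/
def reverse (f : DigLoop κ x₀) : DigLoop κ x₀ where
  len := f.len
  toFun i := f.toFun ⟨f.len - i.val, by omega⟩
  cont := by
    rw [digContinuous_path_iff]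
    intro i hi
    have := (digContinuous_path_iff _ _).1 f.cont (f.len - (i + 1)) (by omega)
    simp only [show f.len - (i + 1) + 1 = f.len - i by omega] at this
    exact this.symm
  source := f.target
  target := by
    simp only [Fin.val_last, Nat.sub_self]
    exact f.source

/-! ### Loops extended to `ℕ` by the constant `x₀` -/

/-- The extension of a loop to `ℕ` by the constant `x₀`. -/
def ext (f : DigLoop κ x₀) (i : ℕ) : X := f.toFun ⟨min i f.len, by omega⟩

/-- Eventually constant based loops on `ℕ`. -/
def IsELoop (κ : SimpleGraph X) (x₀ : X) (a : ℕ → X) : Prop :=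
  a 0 = x₀ ∧ (∀ i, Near κ (a i) (a (i + 1))) ∧ ∃ n, ∀ i, n ≤ i → a i = x₀

/-- A one-step homotopy of eventually constant loops. -/
def Step (κ : SimpleGraph X) (x₀ : X) (a b : ℕ → X) : Prop :=
  IsELoop κ x₀ a ∧ IsELoop κ x₀ b ∧ ∀ i, Near κ (a i) (b i)

/-- Homotopy of eventually constant loops. -/
def EHom (κ : SimpleGraph X) (x₀ : X) : (ℕ → X) → (ℕ → X) → Prop :=
  Relation.ReflTransGen (Step κ x₀)

lemma EHom.symm {a b : ℕ → X} (h : EHom κ x₀ a b) : EHom κ x₀ b a := by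
  have hs : ∀ a b, Step κ x₀ a b → Step κ x₀ b a :=
    fun _ _ h => ⟨h.2.1, h.1, fun i => (h.2.2 i).symm⟩
  induction h with
  | refl => exact Relation.ReflTransGen.refl
  | tail _ hbc ih => exact Relation.ReflTransGen.head (hs _ _ hbc) ih

lemma EHom.trans {a b c : ℕ → X} (h : EHom κ x₀ a b) (h' : EHom κ x₀ b c) : EHom κ x₀ a c :=
  Relation.ReflTransGen.trans h h'

/-- A finite family of eventually constant loops, successively pointwise near, is a homotopy. -/
lemma EHom.of_family (A : ℕ → ℕ → X) (hA : ∀ t, IsELoop κ x₀ (A t))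
    (hn : ∀ t i, Near κ (A t i) (A (t + 1) i)) (m : ℕ) : EHom κ x₀ (A 0) (A m) := by
  induction m with
  | zero => exact Relation.ReflTransGen.refl
  | succ m ih => exact Relation.ReflTransGen.tail ih ⟨hA m, hA (m + 1), hn m⟩

lemma EHom.of_family' (A : ℕ → ℕ → X) {a b : ℕ → X} {m : ℕ} (h0 : a = A 0) (h1 : b = A m)
    (hA : ∀ t, IsELoop κ x₀ (A t)) (hn : ∀ t i, Near κ (A t i) (A (t + 1) i)) :
    EHom κ x₀ a b := by
  subst h0 h1
  exact EHom.of_family A hA hn m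

lemma ext_of_le (f : DigLoop κ x₀) {i : ℕ} (h : f.len ≤ i) : f.ext i = x₀ := by
  unfold ext
  simp only [min_eq_right h]
  exact f.target

lemma ext_zero (f : DigLoop κ x₀) : f.ext 0 = x₀ := by
  unfold ext
  simp only [Nat.zero_min]
  exact f.source

lemma ext_near (f : DigLoop κ x₀) (i : ℕ) : Near κ (f.ext i) (f.ext (i + 1)) := by
  by_cases h : i < f.len
  · unfold ext
    simp only [min_eq_left h.le, min_eq_left (Nat.succ_le_of_lt h)]
    exact (digContinuous_path_iff _ _).1 f.cont i (by omega)
  · rw [ext_of_le f (by omega), ext_of_le f (by omega)]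
    exact Near.refl _ _

lemma ext_isELoop (f : DigLoop κ x₀) : IsELoop κ x₀ f.ext :=
  ⟨f.ext_zero, f.ext_near, f.len, fun _ h => f.ext_of_le h⟩

lemma near_of_lip {a : ℕ → X} (ha : ∀ i, Near κ (a i) (a (i + 1))) {i j : ℕ}
    (h1 : i ≤ j + 1) (h2 : j ≤ i + 1) : Near κ (a i) (a j) := by
  rcases lt_trichotomy i j with h | h | h
  · obtain rfl : j = i + 1 := by omega
    exact ha i
  · subst h
    exact Near.refl _ _
  · obtain rfl : i = j + 1 := by omega
    exact (ha j).symm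

/-- A monotone surjection between integer intervals moves by steps of size at most one. -/
lemma surj_lip {m n : ℕ} {r : Fin (n + 1) → Fin (m + 1)} (hm : Monotone r)
    (hs : Function.Surjective r) (i : ℕ) (hi : i + 1 < n + 1) :
    (r ⟨i + 1, hi⟩).val ≤ (r ⟨i, by omega⟩).val + 1 := by
  by_contra hlt
  push Not at hlt
  obtain ⟨k, hk⟩ := hs ⟨(r ⟨i, by omega⟩).val + 1, by have := (r ⟨i + 1, hi⟩).2; omega⟩
  have hkv := congrArg Fin.val hk
  simp only at hkv
  rcases Nat.lt_or_ge i k.val with h | h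
  · have h2 : (r ⟨i + 1, hi⟩).val ≤ (r k).val := hm (Fin.mk_le_of_le_val h)
    omega
  · have h2 : (r k).val ≤ (r ⟨i, by omega⟩).val := hm (show k ≤ ⟨i, by omega⟩ from h)
    omega

lemma surj_zero {m n : ℕ} {r : Fin (n + 1) → Fin (m + 1)} (hm : Monotone r)
    (hs : Function.Surjective r) : (r 0).val = 0 := by
  obtain ⟨k, hk⟩ := hs 0
  have h2 : (r 0).val ≤ (r k).val := hm (Fin.zero_le k)
  rw [hk] at h2
  simpa using h2

lemma surj_last {m n : ℕ} {r : Fin (n + 1) → Fin (m + 1)} (hm : Monotone r)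
    (hs : Function.Surjective r) : (r (Fin.last n)).val = m := by
  obtain ⟨k, hk⟩ := hs (Fin.last m)
  have h2 : (r k).val ≤ (r (Fin.last n)).val := hm (Fin.le_last k)
  rw [hk] at h2
  have := (r (Fin.last n)).2
  simp only [Fin.val_last] at h2
  omega

/-- A trivial extension is homotopic to the original loop. -/
lemma ehom_trivialExtension (f : DigLoop κ x₀) {n : ℕ} {f' : Fin (n + 1) → X}
    (h : IsTrivialExtension f.toFun f') :
    EHom κ x₀ (fun i => f' ⟨min i n, by omega⟩) f.ext := by
  obtain ⟨r, hm, hs, hr⟩ := h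
  set R : ℕ → ℕ := fun i => (r ⟨min i n, by omega⟩).val with hR
  have hR0 : R 0 = 0 := by
    simp only [hR, Nat.zero_min]
    exact surj_zero hm hs
  have hRn : ∀ i, n ≤ i → R i = f.len := by
    intro i hi
    simp only [hR, min_eq_right hi]
    exact surj_last hm hs
  have hRlip : ∀ i, R (i + 1) ≤ R i + 1 ∧ R i ≤ R (i + 1) := by
    intro i
    by_cases h : i < n
    · constructor
      · simp only [hR, min_eq_left h.le, min_eq_left (Nat.succ_le_of_lt h)]
        exact surj_lip hm hs i (by omega)
      · exact hm (by simp only [Fin.mk_le_mk]; omega)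
    · rw [hRn i (by omega), hRn (i + 1) (by omega)]
      omega
  have hRle : ∀ i, R i ≤ i := by
    intro i
    induction i with
    | zero => omega
    | succ i ih => have := (hRlip i).1; omega
  have hRm : ∀ i, R i ≤ f.len := fun i => by
    have := (r ⟨min i n, by omega⟩).2
    simp only [hR]
    omega
  have e0 : (fun i => f' ⟨min i n, by omega⟩) =
      (fun t i => f.ext (max (R i) (min (min i f.len) t))) 0 := by
    funext i
    simp only [Nat.min_zero, Nat.max_zero, hr, ext]
    congr 1
    apply Fin.ext
    simp only [min_eq_left (hRm i)]
    rfl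
  have e1 : f.ext = (fun t i => f.ext (max (R i) (min (min i f.len) t))) f.len := by
    funext i
    have h1 := hRle i
    have h2 := hRm i
    have : max (R i) (min (min i f.len) f.len) = min i f.len := by omega
    simp only [this, ext]
    congr 1
    apply Fin.ext
    simp only
    omega
  refine EHom.of_family' (fun t i => f.ext (max (R i) (min (min i f.len) t))) e0 e1 (fun t => ⟨?_, fun i => ?_, max n f.len, fun i hi => ?_⟩)
    (fun t i => ?_)
  · simp only [hR0, Nat.zero_min, max_self]
    exact f.ext_zero
  · have := hRlip i
    exact near_of_lip f.ext_near (by omega) (by omega)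
  · apply ext_of_le
    rw [hRn i (by omega)]
    omega
  · exact near_of_lip f.ext_near (by omega) (by omega)

/-- An explicit homotopy from a chain of one-step homotopies. -/
lemma EHom.exists_family {a b : ℕ → X} (ha : IsELoop κ x₀ a) (h : EHom κ x₀ a b) :
    ∃ (m : ℕ) (A : ℕ → ℕ → X), A 0 = a ∧ A m = b ∧ (∀ t, IsELoop κ x₀ (A t)) ∧
      (∀ t i, Near κ (A t i) (A (t + 1) i)) ∧ ∃ n, ∀ t i, n ≤ i → A t i = x₀ := by
  induction h with
  | refl =>
    obtain ⟨n, hn⟩ := ha.2.2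
    exact ⟨0, fun _ => a, rfl, rfl, fun _ => ha, fun _ _ => Near.refl _ _, n, fun _ => hn⟩
  | @tail b c _ hbc ih =>
    obtain ⟨m, A, h0, hm, hA, hn, n, hN⟩ := ih
    obtain ⟨hb, hc, hnear⟩ := hbc
    obtain ⟨k, hk⟩ := hc.2.2
    refine ⟨m + 1, fun t => if t ≤ m then A t else c, ?_, ?_, fun t => ?_, fun t i => ?_,
      max n k, fun t i hi => ?_⟩
    · simpa using h0
    · simp
    · by_cases h : t ≤ m <;> simp [h, hA, hc]
    · rcases lt_trichotomy t m with h | h | h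
      · simpa [h.le, Nat.succ_le_of_lt h] using hn t i
      · subst h
        simpa [hm] using hnear i
      · simpa [show ¬ t ≤ m by omega, show ¬ t + 1 ≤ m by omega] using Near.refl κ (c i)
    · by_cases h : t ≤ m
      · simpa [h] using hN t i (by omega)
      · simpa [h] using hk i (by omega)

lemma isTrivialExtension_ext (f : DigLoop κ x₀) {n : ℕ} (h : f.len ≤ n) :
    IsTrivialExtension f.toFun (fun i : Fin (n + 1) => f.ext i.val) := by
  refine ⟨fun i => ⟨min i.val f.len, by omega⟩, ?_, ?_, fun i => rfl⟩
  · intro i j hij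
    have : i.val ≤ j.val := hij
    simp only [Fin.mk_le_mk]
    omega
  · intro j
    refine ⟨⟨j.val, by omega⟩, ?_⟩
    apply Fin.ext
    simp only
    omega

/-- Loop classes in terms of the extensions to `ℕ`. -/
theorem sameClass_iff (f g : DigLoop κ x₀) : SameClass f g ↔ EHom κ x₀ f.ext g.ext := by
  constructor
  · rintro ⟨n, f', g', hf, hg, m, F, hF, hend⟩
    refine (ehom_trivialExtension f hf).symm.trans (EHom.trans ?_ (ehom_trivialExtension g hg))
    have e0 : (fun i => f' ⟨min i n, by omega⟩) =
        (fun t i => F ⟨min i n, by omega⟩ ⟨min t m, by omega⟩ : ℕ → ℕ → X) 0 := by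
      funext i
      rw [← hF.start]
      simp
    have e1 : (fun i => g' ⟨min i n, by omega⟩) =
        (fun t i => F ⟨min i n, by omega⟩ ⟨min t m, by omega⟩ : ℕ → ℕ → X) m := by
      funext i
      rw [← hF.finish]
      simp only [min_self]
      rfl
    refine EHom.of_family' (fun t i => F ⟨min i n, by omega⟩ ⟨min t m, by omega⟩) e0 e1 (fun t => ⟨?_, fun i => ?_, n, fun i hi => ?_⟩) (fun t i => ?_)
    · simp only [Nat.zero_min]
      exact (hend _).1
    · by_cases h : i < n
      · have := (digContinuous_path_iff _ _).1 (hF.cont_space ⟨min t m, by omega⟩) i (by omega)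
        simpa only [min_eq_left h.le, min_eq_left (Nat.succ_le_of_lt h)] using this
      · simp only [min_eq_right (show n ≤ i by omega), min_eq_right (show n ≤ i + 1 by omega)]
        exact Near.refl _ _
    · simp only [min_eq_right hi]
      exact (hend _).2
    · by_cases h : t < m
      · have := (digContinuous_path_iff _ _).1 (hF.cont_time ⟨min i n, by omega⟩) t (by omega)
        simpa only [min_eq_left h.le, min_eq_left (Nat.succ_le_of_lt h)] using this
      · simp only [min_eq_right (show m ≤ t by omega), min_eq_right (show m ≤ t + 1 by omega)]
        exact Near.refl _ _
  · intro h
    obtain ⟨m, A, h0, hm, hA, hn, n, hN⟩ := h.exists_family f.ext_isELoop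
    have hcont : ∀ (a : ℕ → X), IsELoop κ x₀ a → ∀ k : ℕ,
        DigContinuous (SimpleGraph.pathGraph (k + 1)) κ (fun i : Fin (k + 1) => a i.val) :=
      fun a ha k => (digContinuous_path_iff _ _).2 fun i _ => ha.2.1 i
    refine ⟨n + f.len + g.len, fun i => f.ext i.val, fun i => g.ext i.val,
      isTrivialExtension_ext f (by omega), isTrivialExtension_ext g (by omega), m + 1,
      fun i t => A (min t.val m) i.val,
      ⟨Nat.succ_pos _, hcont _ f.ext_isELoop _, hcont _ g.ext_isELoop _, fun i => ?_, fun i => ?_,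
        fun i => ?_, fun t => hcont _ (hA _) _⟩, fun t => ⟨(hA _).1, hN _ _ ?_⟩⟩
    · simp [h0]
    · simp [hm]
    · rw [digContinuous_path_iff]
      intro t ht
      by_cases h : t < m
      · simpa only [min_eq_left h.le, min_eq_left (Nat.succ_le_of_lt h)] using hn t i
      · simp only [min_eq_right (show m ≤ t by omega), min_eq_right (show m ≤ t + 1 by omega)]
        exact Near.refl _ _
    · simp only [Fin.val_last]
      omega

/-- Being in the same loop class is an equivalence relation. -/
instance setoid (κ : SimpleGraph X) (x₀ : X) : Setoid (DigLoop κ x₀) where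
  r := SameClass
  iseqv :=
    { refl := fun f => (sameClass_iff f f).2 Relation.ReflTransGen.refl
      symm := fun {f g} h => (sameClass_iff g f).2 ((sameClass_iff f g).1 h).symm
      trans := fun {f g k} h h' => (sameClass_iff f k).2
        (((sameClass_iff f g).1 h).trans ((sameClass_iff g k).1 h')) }

/-! ### Products and inverses of loop classes -/

/-- Concatenation of functions on `ℕ`, the second one starting at time `n`. -/
def ecat (a : ℕ → X) (n : ℕ) (b : ℕ → X) (i : ℕ) : X := if i ≤ n then a i else b (i - n)

lemma ext_concat (f g : DigLoop κ x₀) : (concat f g).ext = ecat f.ext f.len g.ext := by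
  funext i
  have hlen : (concat f g).len = f.len + g.len := rfl
  by_cases h : i ≤ f.len
  · have h1 : min i (f.len + g.len) ≤ f.len := by omega
    simp only [ext, concat, ecat, h, h1, dite_true, if_true]
    congr 1
    apply Fin.ext
    simp only
    omega
  · simp only [ecat, h, if_false]
    by_cases h2 : f.len + g.len ≤ i
    · rw [ext_of_le _ (by omega), ext_of_le _ (by omega)]
    · have h1 : ¬ min i (f.len + g.len) ≤ f.len := by omega
      simp only [ext, concat, h1, dite_false]
      congr 1
      apply Fin.ext
      simp only
      omega

lemma ecat_isELoop {a b : ℕ → X} {n : ℕ} (ha : IsELoop κ x₀ a) (hb : IsELoop κ x₀ b)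
    (hn : ∀ i, n ≤ i → a i = x₀) : IsELoop κ x₀ (ecat a n b) := by
  obtain ⟨k, hk⟩ := hb.2.2
  refine ⟨by simp [ecat, ha.1], fun i => ?_, n + k + 1, fun i hi => ?_⟩
  · unfold ecat
    rcases lt_trichotomy i n with h | h | h
    · simpa [h.le, Nat.succ_le_of_lt h] using ha.2.1 i
    · subst h
      have := hb.2.1 0
      rw [hb.1] at this
      simpa [hn i le_rfl] using this
    · simpa [show ¬ i ≤ n by omega, show ¬ i + 1 ≤ n by omega,
        show i + 1 - n = i - n + 1 by omega] using hb.2.1 (i - n)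
  · simp only [ecat, show ¬ i ≤ n by omega, if_false]
    exact hk _ (by omega)

lemma ecat_delay {a b : ℕ → X} {n : ℕ} (ha : IsELoop κ x₀ a) (hb : IsELoop κ x₀ b)
    (hn : ∀ i, n ≤ i → a i = x₀) (k : ℕ) : EHom κ x₀ (ecat a n b) (ecat a (n + k) b) := by
  refine EHom.of_family (fun k => ecat a (n + k) b)
    (fun k => ecat_isELoop ha hb fun i hi => hn i (by omega)) (fun t i => ?_) k
  simp only [ecat]
  rcases lt_trichotomy i (n + t + 1) with h | h | h
  · simp only [show i ≤ n + t by omega, show i ≤ n + (t + 1) by omega, if_true]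
    exact Near.refl _ _
  · simp only [show ¬ i ≤ n + t by omega, show i ≤ n + (t + 1) by omega, if_true, if_false]
    rw [hn i (by omega), show i - (n + t) = 0 + 1 by omega, ← hb.1]
    exact (hb.2.1 0).symm
  · simp only [show ¬ i ≤ n + t by omega, show ¬ i ≤ n + (t + 1) by omega, if_false]
    exact near_of_lip hb.2.1 (by omega) (by omega)

lemma ecat_delay' {a b : ℕ → X} {n n' : ℕ} (ha : IsELoop κ x₀ a) (hb : IsELoop κ x₀ b)
    (hn : ∀ i, n ≤ i → a i = x₀) (hn' : ∀ i, n' ≤ i → a i = x₀) :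
    EHom κ x₀ (ecat a n b) (ecat a n' b) := by
  have h1 := ecat_delay ha hb hn n'
  have h2 := ecat_delay ha hb hn' n
  rw [Nat.add_comm n' n] at h2
  exact h1.trans h2.symm

lemma ecat_congr_left {a a' b : ℕ → X} (ha : IsELoop κ x₀ a) (hb : IsELoop κ x₀ b)
    (h : EHom κ x₀ a a') {n : ℕ} (hn : ∀ i, n ≤ i → a i = x₀) {n' : ℕ}
    (hn' : ∀ i, n' ≤ i → a' i = x₀) : EHom κ x₀ (ecat a n b) (ecat a' n' b) := by
  induction h generalizing n' with
  | refl => exact ecat_delay' ha hb hn hn'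
  | @tail c d _ hcd ih =>
    obtain ⟨hc, hd, hnear⟩ := hcd
    obtain ⟨k, hk⟩ := hc.2.2
    have h1 : EHom κ x₀ (ecat a n b) (ecat c (k + n') b) := ih fun i hi => hk i (by omega)
    have h2 : Step κ x₀ (ecat c (k + n') b) (ecat d (k + n') b) := by
      refine ⟨ecat_isELoop hc hb fun i hi => hk i (by omega),
        ecat_isELoop hd hb fun i hi => hn' i (by omega), fun i => ?_⟩
      by_cases h : i ≤ k + n'
      · simpa [ecat, h] using hnear i
      · simpa [ecat, h] using Near.refl κ _
    exact (Relation.ReflTransGen.tail h1 h2).trans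
      (ecat_delay' hd hb (fun i hi => hn' i (by omega)) hn')

lemma ecat_congr_right {a b b' : ℕ → X} (ha : IsELoop κ x₀ a)
    (h : EHom κ x₀ b b') {n : ℕ} (hn : ∀ i, n ≤ i → a i = x₀) :
    EHom κ x₀ (ecat a n b) (ecat a n b') := by
  induction h with
  | refl => exact Relation.ReflTransGen.refl
  | @tail c d _ hcd ih =>
    obtain ⟨hc, hd, hnear⟩ := hcd
    refine Relation.ReflTransGen.tail ih
      ⟨ecat_isELoop ha hc hn, ecat_isELoop ha hd hn, fun i => ?_⟩
    by_cases h : i ≤ n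
    · simpa [ecat, h] using Near.refl κ _
    · simpa [ecat, h] using hnear (i - n)

theorem concat_congr {f f' g g' : DigLoop κ x₀} (hf : SameClass f f') (hg : SameClass g g') :
    SameClass (concat f g) (concat f' g') := by
  rw [sameClass_iff] at *
  rw [ext_concat, ext_concat]
  exact (ecat_congr_left f.ext_isELoop g.ext_isELoop hf (fun _ h => f.ext_of_le h)
    (fun _ h => f'.ext_of_le h)).trans
    (ecat_congr_right f'.ext_isELoop hg (fun _ h => f'.ext_of_le h))

lemma ext_reverse (f : DigLoop κ x₀) : (reverse f).ext = fun i => f.ext (f.len - i) := by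
  funext i
  simp only [ext, reverse]
  congr 1
  apply Fin.ext
  simp only
  omega

lemma erev_isELoop {a : ℕ → X} {n : ℕ} (ha : IsELoop κ x₀ a) (hn : ∀ i, n ≤ i → a i = x₀) :
    IsELoop κ x₀ (fun i => a (n - i)) := by
  refine ⟨hn _ (by omega), fun i => near_of_lip ha.2.1 (by omega) (by omega), n, fun i hi => ?_⟩
  simp only [Nat.sub_eq_zero_of_le hi]
  exact ha.1

lemma erev_delay {a : ℕ → X} {n n' : ℕ} (ha : IsELoop κ x₀ a) (hn : ∀ i, n ≤ i → a i = x₀)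
    (hn' : ∀ i, n' ≤ i → a i = x₀) :
    EHom κ x₀ (fun i => a (n - i)) (fun i => a (n' - i)) := by
  have key : ∀ p k : ℕ, (∀ i, p ≤ i → a i = x₀) →
      EHom κ x₀ (fun i => a (p - i)) (fun i => a (p + k - i)) := fun p k hp =>
    EHom.of_family (fun k i => a (p + k - i))
      (fun k => erev_isELoop ha fun i hi => hp i (by omega))
      (fun t i => near_of_lip ha.2.1 (by omega) (by omega)) k
  have h1 := key n n' hn
  have h2 := key n' n hn'
  rw [Nat.add_comm n' n] at h2
  exact h1.trans h2.symm

theorem reverse_congr {f g : DigLoop κ x₀} (h : SameClass f g) :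
    SameClass (reverse f) (reverse g) := by
  rw [sameClass_iff] at *
  rw [ext_reverse, ext_reverse]
  have key : ∀ {a b : ℕ → X} {n : ℕ}, IsELoop κ x₀ a → (∀ i, n ≤ i → a i = x₀) →
      EHom κ x₀ a b → ∀ n', (∀ i, n' ≤ i → b i = x₀) →
      EHom κ x₀ (fun i => a (n - i)) (fun i => b (n' - i)) := by
    intro a b n ha hn hab
    induction hab with
    | refl => exact fun n' hn' => erev_delay ha hn hn'
    | @tail c d _ hcd ih =>
      intro n' hn'
      obtain ⟨hc, hd, hnear⟩ := hcd
      obtain ⟨k, hk⟩ := hc.2.2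
      have h1 := ih (k + n') fun i hi => hk i (by omega)
      have h2 : Step κ x₀ (fun i => c (k + n' - i)) (fun i => d (k + n' - i)) :=
        ⟨erev_isELoop hc fun i hi => hk i (by omega),
          erev_isELoop hd fun i hi => hn' i (by omega), fun i => hnear _⟩
      exact (Relation.ReflTransGen.tail h1 h2).trans
        (erev_delay hd (fun i hi => hn' i (by omega)) hn')
  exact key f.ext_isELoop (fun _ h => f.ext_of_le h) h _ (fun _ h => g.ext_of_le h)

lemma ext_const : (const κ x₀).ext = fun _ => x₀ := rfl

theorem reverse_concat (f : DigLoop κ x₀) : SameClass (concat (reverse f) f) (const κ x₀) := by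
  rw [sameClass_iff, ext_concat, ext_reverse, ext_const]
  have hlen : (reverse f).len = f.len := rfl
  have hl := f.ext_near
  have e0 : ecat (fun i => f.ext (f.len - i)) (reverse f).len f.ext =
      (fun t i => f.ext (max (max (f.len - i) (i - f.len)) t)) 0 := by
    funext i
    simp only [ecat, hlen, Nat.max_zero]
    split_ifs with h
    · congr 1
      omega
    · congr 1
      omega
  have e1 : (fun _ => x₀ : ℕ → X) =
      (fun t i => f.ext (max (max (f.len - i) (i - f.len)) t)) f.len := by
    funext i
    exact (f.ext_of_le (by omega)).symm
  refine EHom.of_family' (fun t i => f.ext (max (max (f.len - i) (i - f.len)) t)) e0 e1 (fun t => ⟨?_, fun i => ?_, 2 * f.len, fun i hi => ?_⟩)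
    (fun t i => ?_)
  · exact f.ext_of_le (by omega)
  · exact near_of_lip hl (by omega) (by omega)
  · exact f.ext_of_le (by omega)
  · exact near_of_lip hl (by omega) (by omega)

theorem concat_assoc (f g k : DigLoop κ x₀) :
    SameClass (concat (concat f g) k) (concat f (concat g k)) := by
  rw [sameClass_iff]
  have e : (concat (concat f g) k).ext = (concat f (concat g k)).ext := by
    have hlen : (concat f g).len = f.len + g.len := rfl
    rw [ext_concat, ext_concat, ext_concat, ext_concat, hlen]
    funext i
    simp only [ecat]
    by_cases h1 : i ≤ f.len
    · simp [h1, show i ≤ f.len + g.len by omega]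
    · by_cases h2 : i ≤ f.len + g.len
      · simp [h1, h2, show i - f.len ≤ g.len by omega]
      · simp [h1, h2, show ¬ i - f.len ≤ g.len by omega, Nat.sub_sub]
  rw [e]
  exact Relation.ReflTransGen.refl

theorem const_concat (f : DigLoop κ x₀) : SameClass (concat (const κ x₀) f) f := by
  rw [sameClass_iff]
  have e : (concat (const κ x₀) f).ext = f.ext := by
    have hlen : (const κ x₀).len = 0 := rfl
    rw [ext_concat, hlen]
    funext i
    by_cases h : i ≤ 0
    · obtain rfl : i = 0 := by omega
      simp [ecat, ext_zero]
    · simp [ecat, show i ≠ 0 by omega]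
  rw [e]
  exact Relation.ReflTransGen.refl

theorem concat_const (f : DigLoop κ x₀) : SameClass (concat f (const κ x₀)) f := by
  rw [sameClass_iff]
  have e : (concat f (const κ x₀)).ext = f.ext := by
    rw [ext_concat, ext_const]
    funext i
    by_cases h : i ≤ f.len
    · simp [ecat, h]
    · simp [ecat, h, f.ext_of_le (show f.len ≤ i by omega)]
  rw [e]
  exact Relation.ReflTransGen.refl

end DigLoop

/-- The digital fundamental group `Π₁^κ(X, x₀)`: loop classes of `κ`-loops based at `x₀`. -/
def FundamentalGroup (κ : SimpleGraph X) (x₀ : X) : Type _ := Quotient (DigLoop.setoid κ x₀)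

/-- The group structure `[f] · [g] = [f * g]`. -/
instance (κ : SimpleGraph X) (x₀ : X) : Group (FundamentalGroup κ x₀) where
  mul := Quotient.map₂ DigLoop.concat fun _ _ h _ _ h' => DigLoop.concat_congr h h'
  one := Quotient.mk _ (DigLoop.const κ x₀)
  inv := Quotient.map DigLoop.reverse fun _ _ h => DigLoop.reverse_congr h
  mul_assoc := by
    rintro ⟨f⟩ ⟨g⟩ ⟨k⟩
    exact Quotient.sound (DigLoop.concat_assoc f g k)
  one_mul := by
    rintro ⟨f⟩
    exact Quotient.sound (DigLoop.const_concat f)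
  mul_one := by
    rintro ⟨f⟩
    exact Quotient.sound (DigLoop.concat_const f)
  inv_mul_cancel := by
    rintro ⟨f⟩
    exact Quotient.sound (DigLoop.reverse_concat f)

end FundamentalGroup

end DigitalTopology

/-! A digital simple closed curve with `m` points is the cycle `ℤ/m`. The 4-cycle contracts, so
non-contractibility forces `m ≥ 5`, and such a cycle behaves like a circle with universal cover `ℤ`.

Reading each step of a path as its least absolute residue in `{-1, 0, 1}` lifts the path to `ℤ`
(`cycleLift`). In a one-step homotopy, two consecutive times on two successive paths form a closed
walk of length four. Its lifted increment is a multiple of `m` of absolute value at most `4 < m`,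
hence zero. Thus the lifted increment of a loop is a homotopy invariant (`cycleLift_add_of_near`),
and it is `m` times the winding number.

In the product, `NP_v`-nearness is coordinatewise nearness (`near_NP_iff`), so the winding numbers
of the coordinates give a vector in `ℤ^v`. It is additive under concatenation. It is injective
because a loop with zero winding lifts to a closed path in `ℤ^v`, which contracts by clamping to
shrinking cubes. It is surjective by explicit loops. By `sameClass_iff`, loop classes are handled as
eventually constant loops on `ℕ`, so trivial extensions need no further treatment. -/

namespace DigitalTopology

/-! ### Nearness in the normal product -/

section Product

variable {v : ℕ} {Z : Fin v → Type*} {κ : ∀ i, SimpleGraph (Z i)}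

/-- With `u = v` the upper bound on the number of adjacent coordinates is vacuous; the lower bound
only excludes `p = q`. This decouples the coordinates of paths and homotopies. -/
lemma near_NP_iff {p q : ∀ i, Z i} : Near (NP v κ) p q ↔ ∀ i, Near (κ i) (p i) (q i) := by
  constructor
  · rintro (rfl | ⟨-, -, h⟩) i
    · exact Near.refl _ _
    · by_cases hi : (κ i).Adj (p i) (q i)
      · exact Or.inr hi
      · exact Or.inl (h i hi)
  · intro h
    by_cases hpq : p = q
    · exact Or.inl hpq
    · refine Or.inr ⟨?_, ?_, fun i hi => (h i).resolve_right hi⟩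
      · rw [Nat.one_le_iff_ne_zero, Ne, Set.ncard_eq_zero (Set.toFinite _)]
        intro he
        refine hpq (funext fun i => (h i).resolve_right fun hi => ?_)
        have : i ∈ {i | (κ i).Adj (p i) (q i)} := hi
        simp [he] at this
      · simpa using Set.ncard_le_card {i | (κ i).Adj (p i) (q i)}

end Product

/-! ### Lifting paths from a cycle to `ℤ` -/

section Cycle

variable {X : Type*} {κ : SimpleGraph X} {m : ℕ}

/-- `c` identifies `(X, κ)` with the cycle `ℤ/m`. -/
def IsCyclicCoordinate (κ : SimpleGraph X) (c : X ≃ ZMod m) : Prop :=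
  ∀ x y, Near κ x y ↔ |(c y - c x).valMinAbs| ≤ 1

/-- Least absolute residues lie in `(-m/2, m/2]`, which contains `-1` only once `m ≥ 3`. -/
lemma valMinAbs_intCast_of_abs_le_one (hm : 3 ≤ m) {z : ℤ} (hz : |z| ≤ 1) :
    ((z : ZMod m)).valMinAbs = z := by
  have : NeZero m := ⟨by omega⟩
  rw [ZMod.valMinAbs_spec]
  rw [abs_le] at hz
  exact ⟨rfl, by constructor <;> omega⟩

lemma isCyclicCoordinate_of_adj_iff (hm : 3 ≤ m) {c : X ≃ ZMod m}
    (h : ∀ x y, κ.Adj x y ↔ c x + 1 = c y ∨ c y + 1 = c x) : IsCyclicCoordinate κ c := by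
  intro x y
  constructor
  · rintro (rfl | hxy)
    · simp
    · rcases (h x y).1 hxy with h | h
      · have := valMinAbs_intCast_of_abs_le_one hm (z := 1) (by simp)
        rw [← h, add_sub_cancel_left]
        simp only [Int.cast_one] at this
        simp [this]
      · have := valMinAbs_intCast_of_abs_le_one hm (z := -1) (by simp)
        rw [← h, sub_add_cancel_left]
        simp only [Int.cast_neg, Int.cast_one] at this
        simp [this]
  · intro hz
    have hc := ZMod.coe_valMinAbs (c y - c x)
    generalize (c y - c x).valMinAbs = z at hz hc
    rw [abs_le] at hz
    obtain rfl | rfl | rfl : z = 0 ∨ z = 1 ∨ z = -1 := by omega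
    · refine Or.inl (c.injective ?_)
      simp only [Int.cast_zero] at hc
      exact (sub_eq_zero.1 hc.symm).symm
    · refine Or.inr ((h x y).2 (Or.inl ?_))
      simp only [Int.cast_one] at hc
      rw [hc]; ring
    · refine Or.inr ((h x y).2 (Or.inr ?_))
      simp only [Int.cast_neg, Int.cast_one] at hc
      have : (1 : ZMod m) = c x - c y := by rw [← neg_sub, ← hc, neg_neg]
      rw [this]; ring

/-- The increment of a path on the cycle up to time `N`, measured in the universal cover `ℤ`. -/
def cycleLift (c : X ≃ ZMod m) (a : ℕ → X) (N : ℕ) : ℤ :=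
  ∑ i ∈ Finset.range N, (c (a (i + 1)) - c (a i)).valMinAbs

lemma cycleLift_succ (c : X ≃ ZMod m) (a : ℕ → X) (N : ℕ) :
    cycleLift c a (N + 1) = cycleLift c a N + (c (a (N + 1)) - c (a N)).valMinAbs :=
  Finset.sum_range_succ _ _

/-- The increments telescope modulo `m`; so `cycleLift` is a genuine lift of the path, translated to
start at `0`. -/
lemma coe_cycleLift (c : X ≃ ZMod m) (a : ℕ → X) (N : ℕ) :
    ((cycleLift c a N : ℤ) : ZMod m) = c (a N) - c (a 0) := by
  induction N with
  | zero => simp [cycleLift]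
  | succ N ih => rw [cycleLift_succ, Int.cast_add, ih, ZMod.coe_valMinAbs]; ring

lemma dvd_cycleLift (c : X ≃ ZMod m) {a : ℕ → X} {N : ℕ} (h : a N = a 0) :
    (m : ℤ) ∣ cycleLift c a N := by
  rw [← ZMod.intCast_zmod_eq_zero_iff_dvd, coe_cycleLift, h, sub_self]

lemma cycleLift_eq_of_le {c : X ≃ ZMod m} {a : ℕ → X} {x : X} {n N : ℕ}
    (h : ∀ i, n ≤ i → a i = x) (hN : n ≤ N) : cycleLift c a N = cycleLift c a n := by
  induction N, hN using Nat.le_induction with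
  | base => rfl
  | succ N hN ih => simp [cycleLift_succ, ih, h N hN, h (N + 1) (by omega)]

lemma cycleLift_ecat (c : X ≃ ZMod m) {a b : ℕ → X} {n : ℕ} (h : a n = b 0) (N : ℕ) :
    cycleLift c (DigLoop.ecat a n b) (n + N) = cycleLift c a n + cycleLift c b N := by
  unfold cycleLift
  rw [Finset.sum_range_add]
  congr 1
  · refine Finset.sum_congr rfl fun i hi => ?_
    have := Finset.mem_range.1 hi
    simp [DigLoop.ecat, show i ≤ n by omega, show i + 1 ≤ n by omega]
  · refine Finset.sum_congr rfl fun i _ => ?_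
    -- At the junction `j = 0`, `ecat` still takes the value `a n`, so the hypothesis `a n = b 0` is
    -- needed there.
    have e : ∀ j, DigLoop.ecat a n b (n + j) = b j := by
      intro j
      rcases Nat.eq_zero_or_pos j with rfl | hj
      · simp [DigLoop.ecat, h]
      · simp [DigLoop.ecat, hj.ne']
    rw [add_assoc, e, e]

/-- Two paths that stay near each other have the same increment, up to the displacement of their
endpoints: a closed walk of length four lifts to a closed walk. -/
lemma cycleLift_add_of_near (hm : 5 ≤ m) {c : X ≃ ZMod m} (hc : IsCyclicCoordinate κ c)
    {a b : ℕ → X} (ha : ∀ i, Near κ (a i) (a (i + 1))) (hb : ∀ i, Near κ (b i) (b (i + 1)))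
    (hab : ∀ i, Near κ (a i) (b i)) (N : ℕ) :
    cycleLift c a N + (c (b N) - c (a N)).valMinAbs =
      (c (b 0) - c (a 0)).valMinAbs + cycleLift c b N := by
  induction N with
  | zero => simp [cycleLift]
  | succ N ih =>
    rw [cycleLift_succ, cycleLift_succ]
    have h1 := abs_le.1 ((hc _ _).1 (ha N))
    have h2 := abs_le.1 ((hc _ _).1 (hb N))
    have h3 := abs_le.1 ((hc _ _).1 (hab N))
    have h4 := abs_le.1 ((hc _ _).1 (hab (N + 1)))
    -- The signed sum around the quadrilateral `a N`, `a (N + 1)`, `b (N + 1)`, `b N` telescopes to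
    -- zero in `ZMod m`.
    have hdvd : (m : ℤ) ∣ (c (a (N + 1)) - c (a N)).valMinAbs +
        (c (b (N + 1)) - c (a (N + 1))).valMinAbs - (c (b N) - c (a N)).valMinAbs -
        (c (b (N + 1)) - c (b N)).valMinAbs := by
      rw [← ZMod.intCast_zmod_eq_zero_iff_dvd]
      push_cast
      ring
    -- Four terms of size at most one: the sum is at most `4 < m`. For `m = 4` the quadrilateral
    -- could wind once around the cycle.
    have := Int.eq_zero_of_abs_lt_dvd hdvd (by rw [abs_lt]; constructor <;> omega)
    omega

/-- The path on the cycle that starts at `x` and lifts to `l`. -/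
def cycleProj (c : X ≃ ZMod m) (x : X) (l : ℕ → ℤ) (i : ℕ) : X := c.symm (c x + (l i : ZMod m))

/-- Allowing two lifts and two indices covers both a time step along one path and the comparison of
successive stages of a homotopy. -/
lemma near_cycleProj (hm : 3 ≤ m) {c : X ≃ ZMod m} (hc : IsCyclicCoordinate κ c) (x : X)
    {l l' : ℕ → ℤ} {i j : ℕ} (h : |l' j - l i| ≤ 1) :
    Near κ (cycleProj c x l i) (cycleProj c x l' j) := by
  rw [hc]
  simp only [cycleProj, Equiv.apply_symm_apply, add_sub_add_left_eq_sub, ← Int.cast_sub,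
    valMinAbs_intCast_of_abs_le_one hm h, h]

lemma cycleProj_of_dvd (c : X ≃ ZMod m) (x : X) {l : ℕ → ℤ} {i : ℕ} (h : (m : ℤ) ∣ l i) :
    cycleProj c x l i = x := by
  rw [cycleProj, (ZMod.intCast_zmod_eq_zero_iff_dvd _ _).2 h, add_zero, Equiv.symm_apply_apply]

lemma cycleProj_cycleLift (c : X ≃ ZMod m) (a : ℕ → X) :
    cycleProj c (a 0) (cycleLift c a) = a := by
  funext i
  simp [cycleProj, coe_cycleLift]

/-- Steps of size at most one are their own least residues, so projecting and lifting again loses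
only the starting value. -/
lemma cycleLift_cycleProj (hm : 3 ≤ m) (c : X ≃ ZMod m) (x : X) {l : ℕ → ℤ}
    (h : ∀ i, |l (i + 1) - l i| ≤ 1) (N : ℕ) :
    cycleLift c (cycleProj c x l) N = l N - l 0 := by
  induction N with
  | zero => simp [cycleLift]
  | succ N ih =>
    rw [cycleLift_succ, ih]
    simp only [cycleProj, Equiv.apply_symm_apply, add_sub_add_left_eq_sub, ← Int.cast_sub,
      valMinAbs_intCast_of_abs_le_one hm (h N)]
    ring

lemma abs_cycleLift_succ_sub {c : X ≃ ZMod m} (hc : IsCyclicCoordinate κ c)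
    {a : ℕ → X} (ha : ∀ i, Near κ (a i) (a (i + 1))) (i : ℕ) :
    |cycleLift c a (i + 1) - cycleLift c a i| ≤ 1 := by
  rw [cycleLift_succ, add_sub_cancel_left]
  exact (hc _ _).1 (ha i)

lemma abs_cycleLift_le {c : X ≃ ZMod m} (hc : IsCyclicCoordinate κ c)
    {a : ℕ → X} (ha : ∀ i, Near κ (a i) (a (i + 1))) (i : ℕ) : |cycleLift c a i| ≤ i := by
  induction i with
  | zero => simp [cycleLift]
  | succ i ih =>
    have := abs_cycleLift_succ_sub hc ha i
    rw [abs_le] at *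
    push_cast
    omega

end Cycle

/-! ### Winding vectors and the fundamental group of a product of cycles -/

section TorusGroup

variable {v : ℕ} {Z : Fin v → Type*} {κ : ∀ i, SimpleGraph (Z i)} {m : Fin v → ℕ}
  {c : ∀ i, Z i ≃ ZMod (m i)} {s : ∀ i, Z i}

/-- The vector of winding numbers of a loop in a product of cycles. -/
def windingVector (c : ∀ i, Z i ≃ ZMod (m i)) (f : DigLoop (NP v κ) s) (i : Fin v) : ℤ :=
  cycleLift (c i) (fun k => f.ext k i) f.len / m i

lemma near_apply {p q : ∀ i, Z i} (h : Near (NP v κ) p q) (i : Fin v) : Near (κ i) (p i) (q i) :=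
  near_NP_iff.1 h i

/-- The division defining the winding number is exact because the loop closes up. -/
lemma mul_windingVector (f : DigLoop (NP v κ) s) (i : Fin v) :
    (m i : ℤ) * windingVector c f i = cycleLift (c i) (fun k => f.ext k i) f.len :=
  Int.mul_ediv_cancel' (dvd_cycleLift _ (by simp [f.ext_of_le le_rfl, f.ext_zero]))

/-- The stages of a homotopy settle at `s` at different times, so increments are compared at all
late `N`. There, as at time `0`, both loops of a step sit at `s` and the endpoint displacements
vanish. -/
lemma exists_cycleLift_eq_of_eHom (hm : ∀ i, 5 ≤ m i)
    (hc : ∀ i, IsCyclicCoordinate (κ i) (c i)) {a b : ℕ → ∀ i, Z i}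
    (h : DigLoop.EHom (NP v κ) s a b) (i : Fin v) :
    ∃ n, ∀ N, n ≤ N → cycleLift (c i) (fun k => a k i) N = cycleLift (c i) (fun k => b k i) N := by
  induction h with
  | refl => exact ⟨0, fun _ _ => rfl⟩
  | tail _ hbd ih =>
    obtain ⟨n, hn⟩ := ih
    obtain ⟨⟨hb0, hb, n₁, hb1⟩, ⟨hd0, hd, n₂, hd1⟩, hnear⟩ := hbd
    refine ⟨max n (max n₁ n₂), fun N hN => (hn N (by omega)).trans ?_⟩
    have := cycleLift_add_of_near (hm i) (hc i) (fun k => near_apply (hb k) i)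
      (fun k => near_apply (hd k) i) (fun k => near_apply (hnear k) i) N
    simpa [hb0, hd0, hb1 N (by omega), hd1 N (by omega)] using this

lemma windingVector_eq_of_sameClass (hm : ∀ i, 5 ≤ m i)
    (hc : ∀ i, IsCyclicCoordinate (κ i) (c i)) {f g : DigLoop (NP v κ) s}
    (h : DigLoop.SameClass f g) : windingVector c f = windingVector c g := by
  funext i
  obtain ⟨n, hn⟩ := exists_cycleLift_eq_of_eHom hm hc ((DigLoop.sameClass_iff f g).1 h) i
  have hf := cycleLift_eq_of_le (c := c i) (a := fun j => f.ext j i) (x := s i)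
    (fun j hj => by rw [f.ext_of_le hj]) (show f.len ≤ n + f.len + g.len by omega)
  have hg := cycleLift_eq_of_le (c := c i) (a := fun j => g.ext j i) (x := s i)
    (fun j hj => by rw [g.ext_of_le hj]) (show g.len ≤ n + f.len + g.len by omega)
  rw [windingVector, windingVector, ← hf, ← hg, hn _ (by omega)]

lemma windingVector_concat (hm : ∀ i, 5 ≤ m i) (f g : DigLoop (NP v κ) s) :
    windingVector c (f.concat g) = windingVector c f + windingVector c g := by
  funext i
  have h0 : (m i : ℤ) ≠ 0 := by have := hm i; omega
  apply mul_left_cancel₀ h0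
  rw [Pi.add_apply, mul_add, mul_windingVector, mul_windingVector, mul_windingVector]
  have e : (fun k => (f.concat g).ext k i) =
      DigLoop.ecat (fun k => f.ext k i) f.len (fun k => g.ext k i) := by
    funext k
    rw [DigLoop.ext_concat]
    simp only [DigLoop.ecat]
    split_ifs <;> rfl
  rw [e]
  exact cycleLift_ecat _ (by rw [f.ext_of_le le_rfl, g.ext_zero]) _

/-- A loop without winding contracts, by contracting its lift to `ℤ^v`. -/
lemma sameClass_const_of_windingVector_eq_zero (hm : ∀ i, 5 ≤ m i)
    (hc : ∀ i, IsCyclicCoordinate (κ i) (c i)) {f : DigLoop (NP v κ) s}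
    (h : windingVector c f = 0) : DigLoop.SameClass f (DigLoop.const (NP v κ) s) := by
  rw [DigLoop.sameClass_iff, DigLoop.ext_const]
  have hnear : ∀ i k, Near (κ i) (f.ext k i) (f.ext (k + 1) i) :=
    fun i k => near_apply (f.ext_near k) i
  -- Zero winding means that the lift itself ends at `0`, not merely at a multiple of `m i`.
  have hend : ∀ i k, f.len ≤ k → cycleLift (c i) (fun j => f.ext j i) k = 0 := by
    intro i k hk
    rw [cycleLift_eq_of_le (x := s i) (fun j hj => by rw [f.ext_of_le hj]) hk,
      ← mul_windingVector, h]
    simp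
  set L : Fin v → ℕ → ℤ := fun i => cycleLift (c i) (fun j => f.ext j i) with hL
  have hlip : ∀ i k, |L i (k + 1) - L i k| ≤ 1 :=
    fun i k => abs_cycleLift_succ_sub (hc i) (hnear i) k
  have hle : ∀ i k, |L i k| ≤ f.len := by
    intro i k
    rcases le_total k f.len with hk | hk
    · exact (abs_cycleLift_le (hc i) (hnear i) k).trans (by exact_mod_cast hk)
    · rw [hL]
      simp only [hend i k hk, abs_zero]
      omega
  -- Stage `t` clamps the lift to the cube of half-width `f.len - t`. Clamping does not increase
  -- step sizes, fixes the endpoint value `0`, and moves each point by at most one per stage. The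
  -- initial cube contains the whole lift by `hle`; at `t = f.len` only the origin remains.
  let C : ℕ → Fin v → ℕ → ℤ := fun t i k =>
    max (min (L i k) ((f.len - t : ℕ) : ℤ)) (-((f.len - t : ℕ) : ℤ))
  refine DigLoop.EHom.of_family' (fun t k i => cycleProj (c i) (s i) (C t i) k) (m := f.len)
    ?_ ?_ (fun t => ⟨?_, fun k => near_NP_iff.2 fun i => ?_, f.len, fun k hk => ?_⟩)
    (fun t k => near_NP_iff.2 fun i => ?_)
  · funext k i
    have e : C 0 i = L i := by
      funext k
      have := abs_le.1 (hle i k)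
      simp only [C]
      omega
    have := congrFun (cycleProj_cycleLift (c i) (fun j => f.ext j i)) k
    simp only [f.ext_zero] at this
    rw [e]
    exact this.symm
  · funext k i
    exact (cycleProj_of_dvd _ _ (by simp [C])).symm
  · funext i
    refine cycleProj_of_dvd _ _ ?_
    have : L i 0 = 0 := by simp [hL, cycleLift]
    simp [C, this]
  · refine near_cycleProj (by have := hm i; omega) (hc i) _ ?_
    have := hlip i k
    rw [abs_le] at *
    simp only [C]
    omega
  · funext i
    refine cycleProj_of_dvd _ _ ?_
    simp [C, show L i k = 0 from hend i k hk]
  · refine near_cycleProj (by have := hm i; omega) (hc i) _ ?_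
    rw [abs_le]
    simp only [C]
    omega

lemma exists_windingVector_eq (hm : ∀ i, 5 ≤ m i)
    (hc : ∀ i, IsCyclicCoordinate (κ i) (c i)) (w : Fin v → ℤ) :
    ∃ f : DigLoop (NP v κ) s, windingVector c f = w := by
  -- Each coordinate walks at unit speed from `0` to `m i * w i` and waits there.
  let l : Fin v → ℕ → ℤ := fun i k => max (min (k : ℤ) (m i * w i)) (-(k : ℤ))
  -- The sum of the distances serves as a common time by which every coordinate has arrived.
  let N : ℕ := ∑ i, (m i * w i : ℤ).natAbs
  have hN : ∀ i k, N ≤ k → l i k = m i * w i := by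
    intro i k hk
    have : (m i * w i : ℤ).natAbs ≤ N :=
      Finset.single_le_sum (f := fun i => (m i * w i : ℤ).natAbs) (fun _ _ => Nat.zero_le _)
        (Finset.mem_univ i)
    simp only [l]
    generalize (m i * w i : ℤ) = z at *
    omega
  have hl0 : ∀ i, l i 0 = 0 := fun i => by
    simp only [l]
    omega
  have hlip : ∀ i k, |l i (k + 1) - l i k| ≤ 1 := by
    intro i k
    rw [abs_le]
    simp only [l]
    generalize (m i * w i : ℤ) = z
    omega
  let f : DigLoop (NP v κ) s :=
    { len := N
      toFun := fun k i => cycleProj (c i) (s i) (l i) k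
      cont := (digContinuous_path_iff _ _).2 fun k _ => near_NP_iff.2 fun i =>
        near_cycleProj (by have := hm i; omega) (hc i) _ (hlip i k)
      source := funext fun i => cycleProj_of_dvd _ _ (by simp [hl0])
      target := funext fun i => cycleProj_of_dvd _ _ (by simp [hN i N le_rfl]) }
  refine ⟨f, funext fun i => ?_⟩
  have h0 : (m i : ℤ) ≠ 0 := by have := hm i; omega
  apply mul_left_cancel₀ h0
  rw [mul_windingVector]
  have e : (fun k => f.ext k i) = cycleProj (c i) (s i) (l i) := by
    funext k
    change cycleProj (c i) (s i) (l i) (min k N) = _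
    rcases le_total k N with hk | hk
    · rw [min_eq_left hk]
    · rw [min_eq_right hk, cycleProj, cycleProj, hN i N le_rfl, hN i k hk]
  rw [e, cycleLift_cycleProj (by have := hm i; omega) _ _ (hlip i), hl0, sub_zero]
  exact hN i N le_rfl

/-- The fundamental group of a product of cycles of lengths at least five. -/
theorem nonempty_fundamentalGroup_NP_mulEquiv (hm : ∀ i, 5 ≤ m i)
    (hc : ∀ i, IsCyclicCoordinate (κ i) (c i)) (s : ∀ i, Z i) :
    Nonempty (FundamentalGroup (NP v κ) s ≃* Multiplicative (Fin v → ℤ)) := by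
  let φ : FundamentalGroup (NP v κ) s →* Multiplicative (Fin v → ℤ) :=
    MonoidHom.mk' (Quotient.lift (fun f => Multiplicative.ofAdd (windingVector c f))
      fun _ _ h => congrArg _ (windingVector_eq_of_sameClass hm hc h)) (by
        rintro ⟨f⟩ ⟨g⟩
        exact congrArg Multiplicative.ofAdd (windingVector_concat hm f g))
  refine ⟨MulEquiv.ofBijective φ ⟨(injective_iff_map_eq_one φ).2 ?_, fun w => ?_⟩⟩
  · rintro ⟨f⟩ hf
    exact Quotient.sound (sameClass_const_of_windingVector_eq_zero hm hc hf)
  · obtain ⟨f, hf⟩ := exists_windingVector_eq (s := s) hm hc w.toAdd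
    exact ⟨Quotient.mk _ f, congrArg Multiplicative.ofAdd hf⟩

end TorusGroup

/-! ### Non-contractible simple closed curves have at least five points -/

section SimpleClosedCurve

variable {X : Type*}

lemma IsSimpleClosedCurve.exists_equiv {κ : SimpleGraph X} {S : Set X}
    (h : IsSimpleClosedCurve κ S) : ∃ m : ℕ, 4 ≤ m ∧ ∃ c : S ≃ ZMod m,
      ∀ x y, (κ.induce S).Adj x y ↔ c x + 1 = c y ∨ c y + 1 = c x := by
  obtain ⟨m, hm, f, hf, rfl, hadj⟩ := h
  obtain ⟨k, rfl⟩ : ∃ k, m = k + 1 := ⟨m - 1, by omega⟩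
  refine ⟨k + 1, hm, (Equiv.ofInjective f hf).symm.trans (ZMod.finEquiv (k + 1)).toEquiv,
    fun x y => ?_⟩
  obtain ⟨i, rfl⟩ := (Equiv.ofInjective f hf).surjective x
  obtain ⟨j, rfl⟩ := (Equiv.ofInjective f hf).surjective y
  have key : ∀ i j : Fin (k + 1), (i.val + 1) % (k + 1) = j.val ↔ i + 1 = j := by
    intro i j
    rw [Fin.ext_iff, Fin.val_add, Fin.val_one', Nat.add_mod_mod]
  have succ_eq_iff : ∀ i j : Fin (k + 1),
      ZMod.finEquiv (k + 1) i + 1 = ZMod.finEquiv (k + 1) j ↔ i + 1 = j := by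
    intro i j
    rw [← map_one (ZMod.finEquiv (k + 1)), ← map_add, EmbeddingLike.apply_eq_iff_eq]
  simp only [Equiv.trans_apply, Equiv.symm_apply_apply, RingEquiv.toEquiv_eq_coe,
    RingEquiv.coe_toEquiv, succ_eq_iff]
  refine (hadj i j).trans ?_
  rw [key, key]

/-- A cycle of length four is contractible. -/
lemma isContractible_of_equiv_zmod_four {κ : SimpleGraph X} (c : X ≃ ZMod 4)
    (h : ∀ x y, κ.Adj x y ↔ c x + 1 = c y ∨ c y + 1 = c x) : IsContractible κ := by
  -- Time `0` is the identity, time `1` folds the square onto the edge `{0, 3}` by `1 ↦ 0`, `2 ↦ 3`,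
  -- and time `2` collapses that edge to `0`.
  let G : ZMod 4 → Fin 3 → ZMod 4 := fun z t =>
    if t = 0 then z else if t = 1 then (if z = 0 ∨ z = 1 then 0 else 3) else 0
  have near_symm_iff : ∀ x y : ZMod 4,
      (x = y ∨ x + 1 = y ∨ y + 1 = x) → Near κ (c.symm x) (c.symm y) := by
    rintro x y (rfl | hxy)
    · exact Near.refl _ _
    · exact Or.inr ((h _ _).2 (by simpa using hxy))
  have hspace : ∀ (x y : ZMod 4) (t : Fin 3), (x + 1 = y ∨ y + 1 = x) →
      (G x t = G y t ∨ G x t + 1 = G y t ∨ G y t + 1 = G x t) := by decide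
  have htime : ∀ (x : ZMod 4) (t : Fin 2), (G x t.castSucc = G x t.succ ∨
      G x t.castSucc + 1 = G x t.succ ∨ G x t.succ + 1 = G x t.castSucc) := by decide
  refine ⟨c.symm 0, 2, fun x t => c.symm (G (c x) t), by norm_num, ?_, ?_, fun x => ?_,
    fun x => rfl, fun x => ?_, fun t => ?_⟩
  · exact (digContinuous_iff _ _ _).2 fun x y hxy => Or.inr hxy
  · exact (digContinuous_iff _ _ _).2 fun x y _ => Near.refl _ _
  · simp [G]
  · exact (digContinuous_path_iff _ _).2 fun t ht =>
      near_symm_iff _ _ (htime (c x) ⟨t, by omega⟩)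
  · exact (digContinuous_iff _ _ _).2 fun x y hxy =>
      near_symm_iff _ _ (hspace _ _ t ((h x y).1 hxy))

/-- Non-contractibility serves only to exclude length four, which supplies the bound `5 ≤ m` of the
quadrilateral argument. -/
lemma IsSimpleClosedCurve.exists_isCyclicCoordinate {κ : SimpleGraph X} {S : Set X}
    (h : IsSimpleClosedCurve κ S) (hnc : ¬ IsContractible (κ.induce S)) :
    ∃ m : ℕ, 5 ≤ m ∧ ∃ c : S ≃ ZMod m, IsCyclicCoordinate (κ.induce S) c := by
  obtain ⟨m, hm, c, hc⟩ := h.exists_equiv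
  rcases hm.eq_or_lt with rfl | hm
  · exact absurd (isContractible_of_equiv_zmod_four c hc) hnc
  · exact ⟨m, hm, c, isCyclicCoordinate_of_adj_iff (by omega) hc⟩

end SimpleClosedCurve

end DigitalTopology

theorem mainTheorem1 (v : ℕ) (n : Fin v → ℕ)
    (κ : ∀ i : Fin v, SimpleGraph (Fin (n i) → ℤ))
    (S : ∀ i : Fin v, Set (Fin (n i) → ℤ))
    (hS : ∀ i, DigitalTopology.IsSimpleClosedCurve (κ i) (S i))
    (hnc : ∀ i, ¬ DigitalTopology.IsContractible ((κ i).induce (S i)))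
    (s : ∀ i, S i) :
    Nonempty (DigitalTopology.FundamentalGroup
      (DigitalTopology.NP v (fun i => (κ i).induce (S i))) s ≃* Multiplicative (Fin v → ℤ)) := by
  choose m hm c hc using fun i => (hS i).exists_isCyclicCoordinate (hnc i)
  exact DigitalTopology.nonempty_fundamentalGroup_NP_mulEquiv hm hc s
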